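/- Let $n\ge 2$ and $r\ge 0$ be integers, and let the real torus $T^r=(S^1)^r$ act continuously and linearly on the unit sphere $S^{2n-1}\subset\mathbb{R}^{2n}$, that is, through a continuous homomorphism $\rho\colon T^r\to O(2n)$ (the action is not required to be effective). Then the orbit space $X=S^{2n-1}/T^r$, with the quotient topology, is simply connected, i.e. it is path-connected and has trivial fundamental group. -/

import Mathlib

namespace TorusQuotient

/-- The real torus of rank `r`, a product of `r` circle groups. -/
abbrev Torus (r : ℕ) : Type := Fin r → Circle

/-- Euclidean space of dimension `2 * n`. -/
abbrev Space (n : ℕ) : Type := EuclideanSpace ℝ (Fin (2 * n))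

/-- The unit sphere of dimension `2 * n - 1`. -/
abbrev OddSphere (n : ℕ) : Type := Metric.sphere (0 : Space n) 1

/-- The action on the unit sphere given by an orthogonal representation of the torus
(`Space n ≃ₗᵢ[ℝ] Space n` is the orthogonal group of degree `2 * n`, under composition). -/
noncomputable abbrev sphereAction {r n : ℕ} (ρ : Torus r →* (Space n ≃ₗᵢ[ℝ] Space n)) :
    MulAction (Torus r) (OddSphere n) where
  smul t x := ⟨ρ t x, by simp⟩
  one_smul x := Subtype.ext (by
    change ρ 1 (x : Space n) = x
    simp)
  mul_smul s t x := Subtype.ext (by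
    change ρ (s * t) (x : Space n) = ρ s (ρ t (x : Space n))
    simp)

/-- Two points of the sphere are equivalent when they lie in the same orbit. -/
noncomputable def orbitSetoid {r n : ℕ} (ρ : Torus r →* (Space n ≃ₗᵢ[ℝ] Space n)) : Setoid (OddSphere n) :=
  @MulAction.orbitRel (Torus r) (OddSphere n) _ (sphereAction ρ)

theorem orbitSetoid_iff {r n : ℕ} (ρ : Torus r →* (Space n ≃ₗᵢ[ℝ] Space n))
    (x y : OddSphere n) :
    orbitSetoid ρ x y ↔ ∃ t : Torus r, ρ t (y : Space n) = x := by
  constructor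
  · rintro ⟨t, ht⟩
    exact ⟨t, congrArg Subtype.val ht⟩
  · rintro ⟨t, ht⟩
    exact ⟨t, Subtype.ext ht⟩

/-- The orbit space of the sphere under the torus action; as a `Quotient` of a topological space
it carries the quotient topology. -/
abbrev OrbitSpace {r n : ℕ} (ρ : Torus r →* (Space n ≃ₗᵢ[ℝ] Space n)) : Type :=
  Quotient (orbitSetoid ρ)

end TorusQuotient

/-! Suppose the torus fixes a unit vector e. The orbits avoiding -e and those avoiding e form two
open sets, each contracting in the orbit space to a point along normalised segments. They meet in
the orbits with nonzero component in the hyperplane orthogonal to e, a path-connected set once the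
dimension is at least three (`simplyConnectedSpace_of_fixed`).

If no nonzero vector is fixed, induct on the dimension. For reducible E = W ⊕ Wᗮ, the orbits with
nonzero W-component deform, by pushing vectors to that component, onto the orbit space of the sphere
of W, simply connected by induction. The same holds for Wᗮ, and the two open sets meet in a
path-connected set (`simplyConnectedSpace_of_invariant`). For irreducible E, Schur's lemma shows
that the group acts through a complex structure; connectedness then makes the action transitive on
the sphere, so the orbit space is a point (`exists_apply_eq_of_irreducible`).

Both coverings are handled by a weak van Kampen theorem, `SimplyConnectedSpace.of_isOpen_cover`. Its
hypothesis on each piece holds because the inclusion is homotopic to a map through a simply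
connected space. The homotopies are written on the sphere and descend because the orbit map is open.
-/

open Set Topology unitInterval Metric

/-! ### Path homotopies and a van Kampen criterion -/

/-- A map homotopic to one that factors through a simply connected space identifies all paths with
common endpoints, up to homotopy. -/
theorem ContinuousMap.Homotopy.map_homotopic_map {A X Y : Type*} [TopologicalSpace A]
    [TopologicalSpace X] [TopologicalSpace Y] [SimplyConnectedSpace Y] {i : C(A, X)}
    {f : C(A, Y)} {g : C(Y, X)} (H : i.Homotopy (g.comp f)) {x y : A} (p q : Path x y) :
    (p.map i.continuous).Homotopic (q.map i.continuous) := by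
  have hp := Path.Homotopic.map_trans_evalAt H p
  have hq := Path.Homotopic.map_trans_evalAt H q
  have hpq : (p.map (map_continuous (g.comp f))).Homotopic (q.map (map_continuous (g.comp f))) :=
    (SimplyConnectedSpace.paths_homotopic (p.map f.continuous) (q.map f.continuous)).map g
  -- The images of p and q under i, each followed by the track of y under H, are both homotopic to
  -- the track of x followed by the same class; the track of y then cancels.
  have h := hp.trans (((Path.Homotopic.refl (H.evalAt x)).hcomp hpq).trans hq.symm)
  rw [← Path.Homotopic.Quotient.eq] at h ⊢
  simp only [Path.Homotopic.Quotient.mk_trans] at h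
  have h2 := congrArg (fun z => z.trans (Path.Homotopic.Quotient.mk (H.evalAt y)).symm) h
  simpa using h2

/-- A space covered by two path-connected open sets with path-connected intersection is simply
connected if paths inside each of the two sets are determined, up to homotopy in the whole space,
by their endpoints. -/
theorem SimplyConnectedSpace.of_isOpen_cover {X : Type*} [TopologicalSpace X] {U V : Set X}
    (hUo : IsOpen U) (hVo : IsOpen V) (hUV : U ∪ V = univ) (hU : IsPathConnected U)
    (hV : IsPathConnected V) (hI : IsPathConnected (U ∩ V))
    (hUp : ∀ {x y : X} (p q : Path x y), (∀ t, p t ∈ U) → (∀ t, q t ∈ U) → p.Homotopic q)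
    (hVp : ∀ {x y : X} (p q : Path x y), (∀ t, p t ∈ V) → (∀ t, q t ∈ V) → p.Homotopic q) :
    SimplyConnectedSpace X := by
  obtain ⟨x₀, hx₀, hI'⟩ := id hI
  -- The candidate for the only class from x₀ to x is that of a path inside U or inside V. When x
  -- lies in both, a path inside U ∩ V shows that the two choices agree.
  have key : ∀ x, ∃ c : Path.Homotopic.Quotient x₀ x, ∀ p : Path x₀ x,
      ((∀ t, p t ∈ U) ∨ (∀ t, p t ∈ V)) → Path.Homotopic.Quotient.mk p = c := by
    intro x
    by_cases hxU : x ∈ U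
    · by_cases hxV : x ∈ V
      · obtain ⟨p, hp⟩ := hI.joinedIn x₀ hx₀ x ⟨hxU, hxV⟩
        refine ⟨.mk p, fun q hq => Path.Homotopic.Quotient.eq.2 ?_⟩
        rcases hq with hq | hq
        · exact hUp q p hq fun t => (hp t).1
        · exact hVp q p hq fun t => (hp t).2
      · obtain ⟨p, hp⟩ := hU.joinedIn x₀ hx₀.1 x hxU
        refine ⟨.mk p, fun q hq => Path.Homotopic.Quotient.eq.2 ?_⟩
        rcases hq with hq | hq
        · exact hUp q p hq hp
        · exact absurd (by simpa using hq 1) hxV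
    · have hxV : x ∈ V := by
        have : x ∈ U ∪ V := hUV ▸ mem_univ x
        exact this.resolve_left hxU
      obtain ⟨p, hp⟩ := hV.joinedIn x₀ hx₀.2 x hxV
      refine ⟨.mk p, fun q hq => Path.Homotopic.Quotient.eq.2 ?_⟩
      rcases hq with hq | hq
      · exact absurd (by simpa using hq 1) hxU
      · exact hVp q p hq hp
  choose κ hκ using key
  have trans_mem : ∀ {W : Set X} {a b c : X} (p : Path a b) (q : Path b c),
      (∀ t, p t ∈ W) → (∀ t, q t ∈ W) → ∀ t, (p.trans q) t ∈ W := by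
    intro W a b c p q hp hq t
    have ht : (p.trans q) t ∈ range (p.trans q) := mem_range_self t
    rw [Path.trans_range] at ht
    rcases ht with ⟨s, hs⟩ | ⟨s, hs⟩
    · exact hs ▸ hp s
    · exact hs ▸ hq s
  have step : ∀ {x y : X} (q : Path x y), ((∀ t, q t ∈ U) ∨ (∀ t, q t ∈ V)) →
      (κ x).trans (.mk q) = κ y := by
    intro x y q hq
    rcases hq with hq | hq
    · obtain ⟨p, hp⟩ := hU.joinedIn x₀ hx₀.1 x (by simpa using hq 0)
      rw [← hκ x p (.inl hp), ← hκ y (p.trans q) (.inl (trans_mem p q hp hq)),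
        Path.Homotopic.Quotient.mk_trans]
    · obtain ⟨p, hp⟩ := hV.joinedIn x₀ hx₀.2 x (by simpa using hq 0)
      rw [← hκ x p (.inr hp), ← hκ y (p.trans q) (.inr (trans_mem p q hp hq)),
        Path.Homotopic.Quotient.mk_trans]
  -- Subdivide γ into pieces lying in U or in V and apply `step` to each.
  have all : ∀ {x y : X} (γ : Path x y), (κ x).trans (.mk γ) = κ y := by
    intro x y γ
    obtain ⟨t, ht0, htm, ⟨N, hN⟩, ht⟩ := exists_monotone_Icc_subset_open_cover_unitInterval
      (c := fun b : Bool => cond b (γ ⁻¹' U) (γ ⁻¹' V))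
      (by rintro (_ | _); exacts [hVo.preimage γ.continuous, hUo.preimage γ.continuous])
      (by
        intro s _
        have : γ s ∈ U ∪ V := hUV ▸ mem_univ _
        rcases this with h | h
        · exact mem_iUnion.2 ⟨true, h⟩
        · exact mem_iUnion.2 ⟨false, h⟩)
    let P : I → Prop := fun s => (κ (γ 0)).trans (.mk (γ.subpath 0 s)) = κ (γ s)
    have hP : ∀ n, P (t n) := by
      intro n
      induction n with
      | zero => rw [ht0]; simp [P]
      | succ n ih =>
        have hmem : ∀ {W : Set X}, Icc (t n) (t (n + 1)) ⊆ γ ⁻¹' W →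
            ∀ s, (γ.subpath (t n) (t (n + 1))) s ∈ W := by
          intro W hW s
          have hs : (γ.subpath (t n) (t (n + 1))) s ∈ range (γ.subpath (t n) (t (n + 1))) :=
            mem_range_self s
          rw [Path.range_subpath_of_le _ _ _ (htm (Nat.le_succ n))] at hs
          obtain ⟨u, hu, hus⟩ := hs
          exact hus ▸ hW hu
        have h1 : (κ (γ (t n))).trans (.mk (γ.subpath (t n) (t (n + 1)))) = κ (γ (t (n + 1))) := by
          apply step
          obtain ⟨_ | _, hi⟩ := ht n
          · exact .inr (hmem hi)
          · exact .inl (hmem hi)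
        have h2 := Path.Homotopic.Quotient.eq.2
          ⟨Path.Homotopy.subpathTransSubpath γ 0 (t n) (t (n + 1))⟩
        change (κ (γ 0)).trans (.mk (γ.subpath 0 (t (n + 1)))) = _
        rw [← h2, ← h1, ← ih, Path.Homotopic.Quotient.mk_trans,
          Path.Homotopic.Quotient.trans_assoc]
    have h1 : P 1 := hN N le_rfl ▸ hP N
    have uncast : ∀ {a b : X} (ha : a = x) (hb : b = y),
        (κ a).trans (.mk (γ.cast ha hb)) = κ b → (κ x).trans (.mk γ) = κ y := by
      intro a b ha hb h
      subst ha hb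
      exact h
    exact uncast γ.source γ.target (by simpa only [P, Path.subpath_zero_one] using h1)
  refine simply_connected_iff_paths_homotopic'.2 ⟨?_, fun {x y} p q => ?_⟩
  · refine pathConnectedSpace_iff_univ.2 (hUV ▸ hU.union hV hI.nonempty)
  · rw [← Path.Homotopic.Quotient.eq]
    have h := congrArg (fun z => (κ x).symm.trans z) ((all p).trans (all q).symm)
    simpa [← Path.Homotopic.Quotient.trans_assoc] using h

/-! ### Descent of maps and homotopies to open quotients -/

/-- A continuous map constant on the fibres of an open quotient map factors through it. -/
theorem IsOpenQuotientMap.exists_continuousMap_lift {S X Y : Type*} [TopologicalSpace S]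
    [TopologicalSpace X] [TopologicalSpace Y] {π : S → X} (hπ : IsOpenQuotientMap π) (f : C(S, Y))
    (hf : ∀ a b, π a = π b → f a = f b) : ∃ F : C(X, Y), ∀ a, F (π a) = f a := by
  have hF : ∀ a, f (Function.surjInv hπ.surjective (π a)) = f a := fun a =>
    hf _ _ (Function.surjInv_eq hπ.surjective (π a))
  refine ⟨⟨fun x => f (Function.surjInv hπ.surjective x), ?_⟩, hF⟩
  exact hπ.continuous_comp_iff.1 (f.continuous.congr fun a => (hF a).symm)

/-- Homotopies of maps on a saturated open set descend to an open quotient. -/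
theorem IsOpenQuotientMap.path_homotopic_of_homotopy {S X Y : Type*} [TopologicalSpace S]
    [TopologicalSpace X] [TopologicalSpace Y] [SimplyConnectedSpace Y] {π : S → X}
    (hπ : IsOpenQuotientMap π) {U : Set X} (h : C((π ⁻¹' U) × I, S))
    (h0 : ∀ x, π (h (x, 0)) = π x)
    (hπh : ∀ x y s, π x.1 = π y.1 → π (h (x, s)) = π (h (y, s)))
    (f : C(π ⁻¹' U, Y)) (hf : ∀ x y, π x.1 = π y.1 → f x = f y)
    (g : C(Y, X)) (h1 : ∀ x, π (h (x, 1)) = g (f x))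
    {x y : X} (p q : Path x y) (hp : ∀ t, p t ∈ U) (hq : ∀ t, q t ∈ U) : p.Homotopic q := by
  have hr : IsOpenQuotientMap (U.restrictPreimage π) :=
    ⟨U.restrictPreimage_surjective hπ.surjective, hπ.continuous.restrictPreimage,
      hπ.isOpenMap.restrictPreimage U⟩
  -- Openness is essential here: a product of a general quotient map with an identity need not be a
  -- quotient map.
  have hrI := hr.prodMap (IsOpenQuotientMap.id (X := I))
  obtain ⟨F, hF⟩ := hr.exists_continuousMap_lift f
    fun a b hab => hf a b (congrArg Subtype.val hab)
  obtain ⟨K, hK'⟩ := hrI.exists_continuousMap_lift ((⟨π, hπ.continuous⟩ : C(S, X)).comp h) (by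
    rintro ⟨a, s⟩ ⟨b, s'⟩ hab
    obtain ⟨hab, rfl⟩ := Prod.ext_iff.1 hab
    exact hπh a b _ (congrArg Subtype.val hab))
  have hK : ∀ a s, K (U.restrictPreimage π a, s) = π (h (a, s)) := fun a s => hK' (a, s)
  let i : C(U, X) := ⟨Subtype.val, continuous_subtype_val⟩
  let H : i.Homotopy (g.comp F) :=
    { toFun := fun z => K (z.2, z.1)
      continuous_toFun := by fun_prop
      map_zero_left := by
        intro u
        obtain ⟨a, rfl⟩ := hr.surjective u
        exact (hK a 0).trans (h0 a)
      map_one_left := by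
        intro u
        obtain ⟨a, rfl⟩ := hr.surjective u
        refine (hK a 1).trans ((h1 a).trans ?_)
        simp [hF] }
  have hx : x ∈ U := by simpa using hp 0
  have hy : y ∈ U := by simpa using hp 1
  let p' : Path (⟨x, hx⟩ : U) ⟨y, hy⟩ :=
    { toFun := fun t => ⟨p t, hp t⟩
      source' := by simp
      target' := by simp }
  let q' : Path (⟨x, hx⟩ : U) ⟨y, hy⟩ :=
    { toFun := fun t => ⟨q t, hq t⟩
      source' := by simp
      target' := by simp }
  exact H.map_homotopic_map p' q'

/-! ### Orbit spaces of unit spheres -/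

namespace OrthogonalAction

variable {G E : Type*} [CommGroup G] [NormedAddCommGroup E] [InnerProductSpace ℝ E]

/-- The orbit relation on the unit sphere of an orthogonal representation. -/
def sphereSetoid (ρ : G →* (E ≃ₗᵢ[ℝ] E)) : Setoid (sphere (0 : E) 1) where
  r x y := ∃ g, ρ g y = (x : E)
  iseqv :=
    { refl := fun x => ⟨1, by simp⟩
      symm := by
        rintro x y ⟨g, hg⟩
        exact ⟨g⁻¹, by rw [← hg, map_inv]; simp⟩
      trans := by
        rintro x y z ⟨g, hg⟩ ⟨h, hh⟩
        exact ⟨g * h, by rw [← hg, ← hh, map_mul]; rfl⟩ }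

/-- The space of orbits in the unit sphere of an orthogonal representation. -/
abbrev SphereQuotient (ρ : G →* (E ≃ₗᵢ[ℝ] E)) : Type _ := Quotient (sphereSetoid ρ)

/-- The orbit of a point of the unit sphere. -/
def orbitClass (ρ : G →* (E ≃ₗᵢ[ℝ] E)) (x : sphere (0 : E) 1) : SphereQuotient ρ :=
  Quotient.mk _ x

theorem orbitClass_eq_iff {ρ : G →* (E ≃ₗᵢ[ℝ] E)} {x y : sphere (0 : E) 1} :
    orbitClass ρ x = orbitClass ρ y ↔ ∃ g, ρ g y = (x : E) :=
  Quotient.eq (r := sphereSetoid ρ)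

/-- The saturation of an open set is the union of its preimages under the group elements, hence
open. -/
theorem isOpenQuotientMap_orbitClass (ρ : G →* (E ≃ₗᵢ[ℝ] E)) :
    IsOpenQuotientMap (orbitClass ρ) := by
  refine ⟨Quotient.mk_surjective, continuous_quotient_mk', fun U hU => ?_⟩
  refine (isQuotientMap_quotient_mk' (s := sphereSetoid ρ)).isOpen_preimage.1 ?_
  have hU' : Quotient.mk (sphereSetoid ρ) ⁻¹' (orbitClass ρ '' U) =
      ⋃ g, (fun x : sphere (0 : E) 1 => (⟨ρ g x, by simp⟩ : sphere (0 : E) 1)) ⁻¹' U := by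
    ext x
    simp only [mem_preimage, mem_image, mem_iUnion]
    constructor
    · rintro ⟨y, hy, hyx⟩
      obtain ⟨g, hg⟩ := orbitClass_eq_iff.1 hyx
      exact ⟨g, by convert hy⟩
    · rintro ⟨g, hg⟩
      exact ⟨_, hg, orbitClass_eq_iff.2 ⟨g, rfl⟩⟩
  change IsOpen (Quotient.mk (sphereSetoid ρ) ⁻¹' _)
  rw [hU']
  exact isOpen_iUnion fun g => hU.preimage
    (((ρ g).continuous.comp continuous_subtype_val).subtype_mk _)

/-- The unit vector in the direction of a nonzero vector. -/
noncomputable def unitVector (v : {v : E // v ≠ 0}) : sphere (0 : E) 1 :=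
  ⟨‖v.1‖⁻¹ • v.1, by
    rw [mem_sphere_zero_iff_norm, norm_smul, norm_inv, norm_norm,
      inv_mul_cancel₀ (norm_ne_zero_iff.2 v.2)]⟩

theorem continuous_unitVector : Continuous (unitVector : {v : E // v ≠ 0} → sphere (0 : E) 1) :=
  ((continuous_subtype_val.norm.inv₀ fun v => norm_ne_zero_iff.2 v.2).smul
    continuous_subtype_val).subtype_mk _

theorem unitVector_coe (x : sphere (0 : E) 1) (hx : (x : E) ≠ 0) : unitVector ⟨(x : E), hx⟩ = x :=
  Subtype.ext (by simp [unitVector])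

theorem orbitClass_unitVector_eq {ρ : G →* (E ≃ₗᵢ[ℝ] E)} {v w : {v : E // v ≠ 0}} (g : G)
    (h : ρ g w = (v : E)) : orbitClass ρ (unitVector v) = orbitClass ρ (unitVector w) := by
  refine orbitClass_eq_iff.2 ⟨g, ?_⟩
  simp [unitVector, ← h]

/-- The restriction of an orthogonal representation to an invariant subspace. -/
def restrict (ρ : G →* (E ≃ₗᵢ[ℝ] E)) (W : Submodule ℝ E) (hW : ∀ g, ∀ x ∈ W, ρ g x ∈ W) :
    G →* (W ≃ₗᵢ[ℝ] W) where
  toFun g :=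
    { toFun := fun x => ⟨ρ g x, hW g x x.2⟩
      invFun := fun x => ⟨ρ g⁻¹ x, hW g⁻¹ x x.2⟩
      map_add' := fun x y => Subtype.ext (by simp)
      map_smul' := fun c x => Subtype.ext (by simp)
      left_inv := fun x => Subtype.ext (by simp)
      right_inv := fun x => Subtype.ext (by simp)
      norm_map' := fun x => (ρ g).norm_map x }
  map_one' := by
    ext x
    change ρ 1 (x : E) = x
    simp
  map_mul' g h := by
    ext x
    change ρ (g * h) (x : E) = ρ g (ρ h (x : E))
    simp

theorem inner_apply_left (ρ : G →* (E ≃ₗᵢ[ℝ] E)) (g : G) (x y : E) :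
    inner ℝ (ρ g x) y = inner ℝ x (ρ g⁻¹ y) := by
  rw [← (ρ g).inner_map_map x (ρ g⁻¹ y), map_inv]
  simp

theorem orthogonal_invariant {ρ : G →* (E ≃ₗᵢ[ℝ] E)} {W : Submodule ℝ E}
    (hW : ∀ g, ∀ x ∈ W, ρ g x ∈ W) (g : G) (x : E) (hx : x ∈ Wᗮ) : ρ g x ∈ Wᗮ := by
  intro y hy
  rw [real_inner_comm, inner_apply_left, real_inner_comm]
  exact hx _ (hW _ _ hy)

/-- The image in the orbit space of the nonzero sums of two path-connected sets of vectors. -/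
theorem isPathConnected_orbitClass_image {ρ : G →* (E ≃ₗᵢ[ℝ] E)} {A B : Set E}
    (hA : IsPathConnected A) (hB : IsPathConnected B) (hAB : ∀ a ∈ A, ∀ b ∈ B, a + b ≠ 0) :
    IsPathConnected {z | ∃ a, ∃ (ha : a ∈ A), ∃ b, ∃ (hb : b ∈ B),
      orbitClass ρ (unitVector ⟨a + b, hAB a ha b hb⟩) = z} := by
  have hprod := hA.prod hB
  rw [isPathConnected_iff_pathConnectedSpace] at hprod
  let F : A ×ˢ B → SphereQuotient ρ := fun z =>
    orbitClass ρ (unitVector ⟨z.1.1 + z.1.2, hAB _ z.2.1 _ z.2.2⟩)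
  have hF : Continuous F := (isOpenQuotientMap_orbitClass ρ).continuous.comp
    (continuous_unitVector.comp (Continuous.subtype_mk (by fun_prop) _))
  have := isPathConnected_range hF
  convert this using 1
  ext z
  constructor
  · rintro ⟨a, ha, b, hb, rfl⟩
    exact ⟨⟨(a, b), ha, hb⟩, rfl⟩
  · rintro ⟨⟨⟨a, b⟩, ha, hb⟩, rfl⟩
    exact ⟨a, ha, b, hb, rfl⟩

/-! ### Orbits with nonzero component in an invariant subspace -/

variable [FiniteDimensional ℝ E]

/-- Since Wᗮ is invariant as well, ρ g carries the orthogonal decomposition of x to that of its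
image. -/
theorem starProjection_apply_comm {ρ : G →* (E ≃ₗᵢ[ℝ] E)} {W : Submodule ℝ E}
    (hW : ∀ g, ∀ x ∈ W, ρ g x ∈ W) (g : G) (x : E) :
    W.starProjection (ρ g x) = ρ g (W.starProjection x) := by
  refine Submodule.eq_starProjection_of_mem_orthogonal (hW g _ (W.starProjection_apply_mem x)) ?_
  rw [← map_sub]
  exact orthogonal_invariant hW g _ (W.sub_starProjection_mem_orthogonal x)

/-- The orbits of the points with nonzero component in an invariant subspace. -/
def componentSet (ρ : G →* (E ≃ₗᵢ[ℝ] E)) (W : Submodule ℝ E) : Set (SphereQuotient ρ) :=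
  orbitClass ρ '' {x | W.starProjection (x : E) ≠ 0}

theorem orbitClass_mem_componentSet {ρ : G →* (E ≃ₗᵢ[ℝ] E)} {W : Submodule ℝ E}
    (hW : ∀ g, ∀ x ∈ W, ρ g x ∈ W) {x : sphere (0 : E) 1} :
    orbitClass ρ x ∈ componentSet ρ W ↔ W.starProjection (x : E) ≠ 0 := by
  refine ⟨?_, fun h => ⟨x, h, rfl⟩⟩
  rintro ⟨y, hy, hyx⟩
  obtain ⟨g, hg⟩ := orbitClass_eq_iff.1 hyx
  intro hx
  apply hy
  rw [← hg, starProjection_apply_comm hW, hx, map_zero]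

theorem isOpen_componentSet (ρ : G →* (E ≃ₗᵢ[ℝ] E)) (W : Submodule ℝ E) :
    IsOpen (componentSet ρ W) := by
  refine (isOpenQuotientMap_orbitClass ρ).isOpenMap _ ?_
  exact isOpen_ne_fun (W.starProjection.continuous.comp continuous_subtype_val) continuous_const

/-- Paths among orbits with nonzero component in an invariant subspace `W` are determined up to
homotopy by their endpoints if the orbit space of the unit sphere of `W` is simply connected. -/
theorem path_homotopic_componentSet {ρ : G →* (E ≃ₗᵢ[ℝ] E)} {W : Submodule ℝ E}
    (hW : ∀ g, ∀ x ∈ W, ρ g x ∈ W) [SimplyConnectedSpace (SphereQuotient (restrict ρ W hW))]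
    {x y : SphereQuotient ρ} (p q : Path x y) (hp : ∀ t, p t ∈ componentSet ρ W)
    (hq : ∀ t, q t ∈ componentSet ρ W) : p.Homotopic q := by
  have hmem : ∀ x : orbitClass ρ ⁻¹' componentSet ρ W, W.starProjection (x : E) ≠ 0 :=
    fun x => (orbitClass_mem_componentSet hW).1 x.2
  -- The segment from x to its W-component. The W-component is constant along it, so the segment
  -- avoids 0 and can be normalised.
  let v : (orbitClass ρ ⁻¹' componentSet ρ W) × I → E := fun z =>
    (1 - (z.2 : ℝ)) • (z.1.1 : E) + (z.2 : ℝ) • W.starProjection (z.1.1 : E)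
  have hvP : ∀ z, W.starProjection (v z) = W.starProjection (z.1.1 : E) := by
    intro z
    have : W.starProjection (W.starProjection (z.1.1 : E)) = W.starProjection (z.1.1 : E) :=
      Submodule.starProjection_eq_self_iff.2 (W.starProjection_apply_mem _)
    simp only [v, map_add, map_smul, this]
    rw [← add_smul, sub_add_cancel, one_smul]
  have hv : ∀ z, v z ≠ 0 := fun z hz => hmem z.1 (by rw [← hvP z, hz, map_zero])
  have hvc : Continuous v := by fun_prop
  let h : C((orbitClass ρ ⁻¹' componentSet ρ W) × I, sphere (0 : E) 1) :=
    ⟨fun z => unitVector ⟨v z, hv z⟩, continuous_unitVector.comp (hvc.subtype_mk hv)⟩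
  have hP0 : ∀ x : orbitClass ρ ⁻¹' componentSet ρ W, W.orthogonalProjectionOnto (x : E) ≠ 0 :=
    fun x hx => hmem x (by rw [Submodule.starProjection_apply, hx]; rfl)
  let f : C(orbitClass ρ ⁻¹' componentSet ρ W, SphereQuotient (restrict ρ W hW)) :=
    ⟨fun x => orbitClass (restrict ρ W hW) (unitVector ⟨W.orthogonalProjectionOnto (x : E), hP0 x⟩),
      (isOpenQuotientMap_orbitClass _).continuous.comp
        (continuous_unitVector.comp (Continuous.subtype_mk (p := fun w : W => w ≠ 0) (by fun_prop) hP0))⟩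
  have hn : ∀ x : sphere (0 : W) 1, ((x : W) : E) ∈ sphere (0 : E) 1 := fun x => by
    rw [mem_sphere_zero_iff_norm]
    exact mem_sphere_zero_iff_norm.1 x.2
  -- The map of orbit spaces induced by including the sphere of W in that of E.
  obtain ⟨g, hg⟩ :=
    (isOpenQuotientMap_orbitClass (restrict ρ W hW)).exists_continuousMap_lift
      ⟨fun x => orbitClass ρ ⟨(x.1 : E), hn x⟩,
        (isOpenQuotientMap_orbitClass ρ).continuous.comp
          (Continuous.subtype_mk (by fun_prop) hn)⟩
      (by
        intro a b hab
        obtain ⟨g, hg⟩ := orbitClass_eq_iff.1 hab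
        exact orbitClass_eq_iff.2 ⟨g, congrArg Subtype.val hg⟩)
  refine (isOpenQuotientMap_orbitClass ρ).path_homotopic_of_homotopy (U := componentSet ρ W) h
    ?_ ?_ f ?_ g ?_ p q hp hq
  · intro x
    congr 1
    refine Eq.trans ?_ (unitVector_coe x.1 (ne_zero_of_mem_unit_sphere _))
    simp only [h, v, ContinuousMap.coe_mk]
    congr 2
    simp
  · intro a b s hab
    obtain ⟨g, hg⟩ := orbitClass_eq_iff.1 hab
    refine orbitClass_unitVector_eq g ?_
    simp only [v, map_add, map_smul, ← hg, starProjection_apply_comm hW]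
  · intro a b hab
    obtain ⟨g, hg⟩ := orbitClass_eq_iff.1 hab
    refine orbitClass_unitVector_eq g (Subtype.ext ?_)
    have := starProjection_apply_comm hW g (b : E)
    rw [hg] at this
    exact this.symm
  · intro a
    refine Eq.trans ?_ (hg _).symm
    change orbitClass ρ _ = orbitClass ρ _
    congr 1
    apply Subtype.ext
    simp [h, v, unitVector]

end OrthogonalAction

namespace OrthogonalAction

variable {G E : Type*} [CommGroup G] [NormedAddCommGroup E] [InnerProductSpace ℝ E]
  [FiniteDimensional ℝ E]

omit [FiniteDimensional ℝ E] in
theorem isPathConnected_nonzero {W : Submodule ℝ E} (h : 1 < Module.finrank ℝ W) :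
    IsPathConnected {x : E | x ∈ W ∧ x ≠ 0} := by
  have hr : (1 : Cardinal) < Module.rank ℝ W := by
    exact_mod_cast Module.lt_rank_of_lt_finrank h
  convert! (isPathConnected_compl_singleton_of_one_lt_rank hr (0 : W)).image
    continuous_subtype_val using 1
  ext x
  simp [and_comm]

theorem starProjection_add_orthogonal {W : Submodule ℝ E} {a b : E} (ha : a ∈ W) (hb : b ∈ Wᗮ) :
    W.starProjection (a + b) = a := by
  rw [map_add, Submodule.starProjection_eq_self_iff.2 ha,
    (Submodule.starProjection_apply_eq_zero_iff W).2 hb, add_zero]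

theorem starProjection_unitVector_ne_zero {W : Submodule ℝ E} {v : {v : E // v ≠ 0}}
    (hv : W.starProjection (v : E) ≠ 0) : W.starProjection (unitVector v : E) ≠ 0 := by
  simp only [unitVector, map_smul]
  exact smul_ne_zero (inv_ne_zero (norm_ne_zero_iff.2 v.2)) hv

/-- These orbits are the image of (W \ {0}) + Wᗮ, and W \ {0} is path-connected because W has
dimension at least two. -/
theorem isPathConnected_componentSet (ρ : G →* (E ≃ₗᵢ[ℝ] E)) {W : Submodule ℝ E}
    (h : 1 < Module.finrank ℝ W) : IsPathConnected (componentSet ρ W) := by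
  have hB : IsPathConnected (Wᗮ : Set E) := Wᗮ.convex.isPathConnected ⟨0, Wᗮ.zero_mem⟩
  have hAB : ∀ a ∈ {x : E | x ∈ W ∧ x ≠ 0}, ∀ b ∈ (Wᗮ : Set E), a + b ≠ 0 := by
    intro a ha b hb hab
    apply ha.2
    rw [← starProjection_add_orthogonal ha.1 hb, hab, map_zero]
  convert! isPathConnected_orbitClass_image (ρ := ρ) (isPathConnected_nonzero h) hB hAB using 1
  ext z
  constructor
  · rintro ⟨x, hx, rfl⟩
    refine ⟨_, ⟨W.starProjection_apply_mem x, hx⟩, _, Wᗮ.starProjection_apply_mem x, ?_⟩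
    congr 1
    refine Eq.trans ?_ (unitVector_coe x (ne_zero_of_mem_unit_sphere x))
    congr 2
    exact Submodule.starProjection_add_starProjection_orthogonal (K := W) (x : E)
  · rintro ⟨a, ha, b, hb, rfl⟩
    refine ⟨_, starProjection_unitVector_ne_zero ?_, rfl⟩
    rw [starProjection_add_orthogonal ha.1 hb]
    exact ha.2

/-- The same argument, with the image of (W \ {0}) + (Wᗮ \ {0}). -/
theorem isPathConnected_componentSet_inter {ρ : G →* (E ≃ₗᵢ[ℝ] E)} {W : Submodule ℝ E}
    (hW : ∀ g, ∀ x ∈ W, ρ g x ∈ W) (h : 1 < Module.finrank ℝ W) (h' : 1 < Module.finrank ℝ Wᗮ) :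
    IsPathConnected (componentSet ρ W ∩ componentSet ρ Wᗮ) := by
  have hAB : ∀ a ∈ {x : E | x ∈ W ∧ x ≠ 0}, ∀ b ∈ {x : E | x ∈ Wᗮ ∧ x ≠ 0}, a + b ≠ 0 := by
    intro a ha b hb hab
    apply ha.2
    rw [← starProjection_add_orthogonal ha.1 hb.1, hab, map_zero]
  convert! isPathConnected_orbitClass_image (ρ := ρ) (isPathConnected_nonzero h)
    (isPathConnected_nonzero h') hAB using 1
  ext z
  constructor
  · rintro ⟨⟨x, hx, rfl⟩, hx'⟩
    rw [orbitClass_mem_componentSet (orthogonal_invariant hW)] at hx'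
    refine ⟨_, ⟨W.starProjection_apply_mem x, hx⟩, _, ⟨Wᗮ.starProjection_apply_mem x, hx'⟩, ?_⟩
    congr 1
    refine Eq.trans ?_ (unitVector_coe x (ne_zero_of_mem_unit_sphere x))
    congr 2
    exact Submodule.starProjection_add_starProjection_orthogonal (K := W) (x : E)
  · rintro ⟨a, ha, b, hb, rfl⟩
    refine ⟨⟨_, starProjection_unitVector_ne_zero ?_, rfl⟩,
      ⟨_, starProjection_unitVector_ne_zero ?_, rfl⟩⟩
    · rw [starProjection_add_orthogonal ha.1 hb.1]
      exact ha.2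
    · change Wᗮ.starProjection (a + b) ≠ 0
      rw [add_comm, starProjection_add_orthogonal hb.1 (W.le_orthogonal_orthogonal ha.1)]
      exact hb.2

/-- If the unit spheres of an invariant subspace and of its orthogonal complement, both of
dimension at least two, have simply connected orbit spaces, so has the whole unit sphere. -/
theorem simplyConnectedSpace_of_invariant {ρ : G →* (E ≃ₗᵢ[ℝ] E)} {W : Submodule ℝ E}
    (hW : ∀ g, ∀ x ∈ W, ρ g x ∈ W) (h : 1 < Module.finrank ℝ W) (h' : 1 < Module.finrank ℝ Wᗮ)
    (hs : SimplyConnectedSpace (SphereQuotient (restrict ρ W hW)))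
    (hs' : SimplyConnectedSpace (SphereQuotient (restrict ρ Wᗮ (orthogonal_invariant hW)))) :
    SimplyConnectedSpace (SphereQuotient ρ) := by
  refine .of_isOpen_cover (isOpen_componentSet ρ W) (isOpen_componentSet ρ Wᗮ) ?_
    (isPathConnected_componentSet ρ h) (isPathConnected_componentSet ρ h')
    (isPathConnected_componentSet_inter hW h h') (path_homotopic_componentSet hW)
    (path_homotopic_componentSet (orthogonal_invariant hW))
  refine eq_univ_of_forall fun z => ?_
  obtain ⟨x, rfl⟩ := (isOpenQuotientMap_orbitClass ρ).surjective z
  by_contra hx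
  rw [mem_union, orbitClass_mem_componentSet hW,
    orbitClass_mem_componentSet (orthogonal_invariant hW)] at hx
  push Not at hx
  apply ne_zero_of_mem_unit_sphere x
  rw [← Submodule.starProjection_add_starProjection_orthogonal (K := W) (x : E), hx.1, hx.2,
    add_zero]

/-! ### Actions with a fixed unit vector -/

/-- The orbits of the points other than the antipode of `e`. -/
def compAntipode (ρ : G →* (E ≃ₗᵢ[ℝ] E)) (e : E) : Set (SphereQuotient ρ) :=
  orbitClass ρ '' {x | (x : E) ≠ -e}

omit [FiniteDimensional ℝ E] in
theorem orbitClass_mem_compAntipode {ρ : G →* (E ≃ₗᵢ[ℝ] E)} {e : E} (hfix : ∀ g, ρ g e = e)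
    {x : sphere (0 : E) 1} : orbitClass ρ x ∈ compAntipode ρ e ↔ (x : E) ≠ -e := by
  refine ⟨?_, fun h => ⟨x, h, rfl⟩⟩
  rintro ⟨y, hy, hyx⟩ hx
  obtain ⟨g, hg⟩ := orbitClass_eq_iff.1 hyx
  apply hy
  rw [← hg, hx, map_neg, hfix]

omit [FiniteDimensional ℝ E] in
theorem isOpen_compAntipode (ρ : G →* (E ≃ₗᵢ[ℝ] E)) (e : E) : IsOpen (compAntipode ρ e) :=
  (isOpenQuotientMap_orbitClass ρ).isOpenMap _ (isOpen_ne_fun continuous_subtype_val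
    continuous_const)

-- Stereographic projection parametrises the sphere minus -e by a vector space.
omit [FiniteDimensional ℝ E] in
theorem isPathConnected_compAntipode (ρ : G →* (E ≃ₗᵢ[ℝ] E)) {e : E} (he : ‖e‖ = 1) :
    IsPathConnected (compAntipode ρ e) := by
  have hne : ‖-e‖ = 1 := by rwa [norm_neg]
  refine IsPathConnected.image ?_ (isOpenQuotientMap_orbitClass ρ).continuous
  have h : {x : sphere (0 : E) 1 | (x : E) ≠ -e} = range (stereographic hne).symm := by
    rw [range_stereographic_symm hne (by simpa using he)]
    ext x
    simp [Subtype.ext_iff]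
  rw [h]
  refine isPathConnected_range ?_
  rw [← continuousOn_univ, ← stereographic_target hne]
  exact (stereographic hne).continuousOn_symm

omit [FiniteDimensional ℝ E] in
/-- Away from the antipode of a fixed point, paths of orbits are determined up to homotopy by
their endpoints. -/
theorem path_homotopic_compAntipode {ρ : G →* (E ≃ₗᵢ[ℝ] E)} {e : E} (he : ‖e‖ = 1)
    (hfix : ∀ g, ρ g e = e) {x y : SphereQuotient ρ} (p q : Path x y)
    (hp : ∀ t, p t ∈ compAntipode ρ e) (hq : ∀ t, q t ∈ compAntipode ρ e) : p.Homotopic q := by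
  have hmem : ∀ x : orbitClass ρ ⁻¹' compAntipode ρ e, (x : E) ≠ -e :=
    fun x => (orbitClass_mem_compAntipode hfix).1 x.2
  let v : (orbitClass ρ ⁻¹' compAntipode ρ e) × I → E := fun z =>
    (1 - (z.2 : ℝ)) • (z.1.1 : E) + (z.2 : ℝ) • e
  have hv : ∀ z, v z ≠ 0 := by
    rintro ⟨x, s⟩ hz
    have h1 : (1 - (s : ℝ)) • (x.1 : E) = -((s : ℝ) • e) := eq_neg_of_add_eq_zero_left hz
    have hx : ‖(x.1 : E)‖ = 1 := mem_sphere_zero_iff_norm.1 x.1.2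
    -- Comparing norms forces s = 1/2, and then x = -e, which is excluded.
    have h2 := congrArg norm h1
    rw [norm_neg, norm_smul, norm_smul, hx, he, Real.norm_of_nonneg (sub_nonneg.2 s.2.2),
      Real.norm_of_nonneg s.2.1] at h2
    have hs : (1 - (s : ℝ)) = s := by linarith
    have hs0 : (s : ℝ) ≠ 0 := by intro h; rw [h] at hs; norm_num at hs
    rw [hs, ← smul_neg] at h1
    exact hmem x (smul_right_injective E hs0 h1)
  have hvc : Continuous v := by fun_prop
  let h : C((orbitClass ρ ⁻¹' compAntipode ρ e) × I, sphere (0 : E) 1) :=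
    ⟨fun z => unitVector ⟨v z, hv z⟩, continuous_unitVector.comp (hvc.subtype_mk hv)⟩
  have he0 : e ≠ 0 := norm_ne_zero_iff.1 (by rw [he]; exact one_ne_zero)
  -- The deformation ends at the constant e, so the intermediate simply connected space is a point.
  refine (isOpenQuotientMap_orbitClass ρ).path_homotopic_of_homotopy (U := compAntipode ρ e) h
    ?_ ?_ (.const _ ()) (fun _ _ _ => rfl) (.const Unit (orbitClass ρ (unitVector ⟨e, he0⟩)))
    ?_ p q hp hq
  · intro x
    congr 1
    refine Eq.trans ?_ (unitVector_coe x.1 (ne_zero_of_mem_unit_sphere _))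
    simp only [h, v, ContinuousMap.coe_mk]
    congr 2
    simp
  · intro a b s hab
    obtain ⟨g, hg⟩ := orbitClass_eq_iff.1 hab
    refine orbitClass_unitVector_eq g ?_
    simp only [v, map_add, map_smul, ← hg, hfix]
  · intro a
    change orbitClass ρ _ = orbitClass ρ _
    congr 1
    apply Subtype.ext
    simp [h, v, unitVector]

/-- The orbit space of the unit sphere is simply connected if the action fixes a unit vector and
the dimension is at least three. -/
theorem simplyConnectedSpace_of_fixed {ρ : G →* (E ≃ₗᵢ[ℝ] E)} {e : E} (he : ‖e‖ = 1)
    (hfix : ∀ g, ρ g e = e) (hE : 3 ≤ Module.finrank ℝ E) :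
    SimplyConnectedSpace (SphereQuotient ρ) := by
  have he' : ‖-e‖ = 1 := by rwa [norm_neg]
  have hfix' : ∀ g, ρ g (-e) = -e := fun g => by rw [map_neg, hfix]
  have he0 : e ≠ 0 := norm_ne_zero_iff.1 (by rw [he]; exact one_ne_zero)
  have hW : ∀ g, ∀ x ∈ Submodule.span ℝ {e}, ρ g x ∈ Submodule.span ℝ {e} := by
    intro g x hx
    obtain ⟨c, rfl⟩ := Submodule.mem_span_singleton.1 hx
    rw [map_smul, hfix]
    exact hx
  -- The only unit vectors on the line through e are e and -e.
  have hinter : compAntipode ρ e ∩ compAntipode ρ (-e) =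
      componentSet ρ (Submodule.span ℝ {e})ᗮ := by
    ext z
    obtain ⟨x, rfl⟩ := (isOpenQuotientMap_orbitClass ρ).surjective z
    rw [mem_inter_iff, orbitClass_mem_compAntipode hfix, orbitClass_mem_compAntipode hfix',
      orbitClass_mem_componentSet (orthogonal_invariant hW), Ne, Ne, Ne,
      Submodule.starProjection_apply_eq_zero_iff, Submodule.orthogonal_orthogonal, neg_neg]
    constructor
    · rintro ⟨h1, h2⟩ hx
      obtain ⟨c, hc⟩ := Submodule.mem_span_singleton.1 hx
      have hn : ‖c • e‖ = 1 := hc ▸ mem_sphere_zero_iff_norm.1 x.2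
      rw [norm_smul, he, mul_one, Real.norm_eq_abs] at hn
      rcases eq_or_eq_neg_of_abs_eq hn with rfl | rfl
      · exact h2 (by rw [← hc, one_smul])
      · exact h1 (by rw [← hc, neg_one_smul])
    · intro hx
      refine ⟨fun h => hx ?_, fun h => hx ?_⟩
      · rw [h]
        exact Submodule.neg_mem _ (Submodule.mem_span_singleton_self e)
      · rw [h]
        exact Submodule.mem_span_singleton_self e
  have hdim : 1 < Module.finrank ℝ (Submodule.span ℝ {e})ᗮ := by
    have h1 := Submodule.finrank_add_finrank_orthogonal (Submodule.span ℝ {e})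
    rw [finrank_span_singleton he0] at h1
    omega
  refine .of_isOpen_cover (isOpen_compAntipode ρ e) (isOpen_compAntipode ρ (-e)) ?_
    (isPathConnected_compAntipode ρ he) (isPathConnected_compAntipode ρ he')
    (hinter ▸ isPathConnected_componentSet ρ hdim) (path_homotopic_compAntipode he hfix)
    (path_homotopic_compAntipode he' hfix')
  refine eq_univ_of_forall fun z => ?_
  obtain ⟨x, rfl⟩ := (isOpenQuotientMap_orbitClass ρ).surjective z
  by_contra hx
  rw [mem_union, orbitClass_mem_compAntipode hfix, orbitClass_mem_compAntipode hfix'] at hx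
  push Not at hx
  rw [neg_neg] at hx
  have h2 : (2 : ℝ) • e = 0 := by
    rw [two_smul, ← eq_neg_iff_add_eq_zero]
    exact hx.2.symm.trans hx.1
  exact he0 ((smul_eq_zero.1 h2).resolve_left two_ne_zero)

end OrthogonalAction

/-! ### Irreducible representations: Schur's lemma and transitivity -/

namespace OrthogonalAction

variable {G E : Type*} [CommGroup G] [NormedAddCommGroup E] [InnerProductSpace ℝ E]
  [FiniteDimensional ℝ E]

omit [FiniteDimensional ℝ E] in
theorem mul_apply (ρ : G →* (E ≃ₗᵢ[ℝ] E)) (g h : G) (x : E) : ρ (g * h) x = ρ g (ρ h x) := by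
  rw [map_mul]
  rfl

omit [FiniteDimensional ℝ E] in
theorem one_apply (ρ : G →* (E ≃ₗᵢ[ℝ] E)) (x : E) : ρ 1 x = x := by
  rw [map_one]
  rfl

/-- A symmetric operator commuting with an irreducible orthogonal representation is a scalar. -/
theorem exists_eq_smul_of_commute [Nontrivial E] {ρ : G →* (E ≃ₗᵢ[ℝ] E)}
    (hirr : ∀ W : Submodule ℝ E, (∀ g, ∀ x ∈ W, ρ g x ∈ W) → W = ⊥ ∨ W = ⊤) {A : E →ₗ[ℝ] E}
    (hA : A.IsSymmetric) (hcomm : ∀ g x, A (ρ g x) = ρ g (A x)) : ∃ c : ℝ, ∀ x, A x = c • x := by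
  -- A symmetric operator has a real eigenvalue. The eigenspace is nonzero and invariant, hence
  -- everything.
  have hev := hA.hasEigenvalue_iSup_of_finiteDimensional
  obtain ⟨c, hc⟩ : ∃ c, Module.End.HasEigenvalue A c := ⟨_, hev⟩
  have htop : Module.End.eigenspace A c = ⊤ := by
    refine (hirr _ fun g x hx => ?_).resolve_left hc
    rw [Module.End.mem_eigenspace_iff] at hx ⊢
    rw [hcomm, hx, map_smul]
  exact ⟨c, fun x => Module.End.mem_eigenspace_iff.1 (htop ▸ Submodule.mem_top)⟩

/-- An irreducible orthogonal representation without nonzero fixed vectors, of a commutative group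
all of whose elements are squares, acts through a complex structure. -/
theorem exists_complexStructure [Nontrivial E] {ρ : G →* (E ≃ₗᵢ[ℝ] E)}
    (hsq : ∀ g : G, ∃ h, h * h = g) (hfix : ∀ x, (∀ g, ρ g x = x) → x = 0)
    (hirr : ∀ W : Submodule ℝ E, (∀ g, ∀ x ∈ W, ρ g x ∈ W) → W = ⊥ ∨ W = ⊤) :
    ∃ J : E →ₗ[ℝ] E, (∀ x, J (J x) = -x) ∧ (∀ x y, inner ℝ (J x) y = -inner ℝ x (J y)) ∧
      ∀ g, ∃ c d : ℝ, ∀ x, ρ g x = c • x + d • J x := by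
  have hcomm : ∀ g h x, ρ g (ρ h x) = ρ h (ρ g x) := by
    intro g h x
    have := congrArg (fun k => ρ k x) (mul_comm g h)
    simpa using this
  -- Twice the symmetric and skew parts of ρ g. Schur's lemma makes each S g a scalar, and also each
  -- K g K h, which is symmetric because the skew operators commute.
  let S : G → E →ₗ[ℝ] E := fun g =>
    ((ρ g).toLinearEquiv : E →ₗ[ℝ] E) + ((ρ g⁻¹).toLinearEquiv : E →ₗ[ℝ] E)
  let K : G → E →ₗ[ℝ] E := fun g =>
    ((ρ g).toLinearEquiv : E →ₗ[ℝ] E) - ((ρ g⁻¹).toLinearEquiv : E →ₗ[ℝ] E)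
  have hS : ∀ g x, S g x = ρ g x + ρ g⁻¹ x := fun g x => rfl
  have hK : ∀ g x, K g x = ρ g x - ρ g⁻¹ x := fun g x => rfl
  have hSsymm : ∀ g, (S g).IsSymmetric := by
    intro g x y
    rw [hS, hS, inner_add_left, inner_add_right, inner_apply_left, inner_apply_left, inv_inv,
      add_comm]
  have hKskew : ∀ g x y, inner ℝ (K g x) y = -inner ℝ x (K g y) := by
    intro g x y
    rw [hK, hK, inner_sub_left, inner_sub_right, inner_apply_left, inner_apply_left, inv_inv]
    ring
  have hKcomm : ∀ g h x, K g (ρ h x) = ρ h (K g x) := by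
    intro g h x
    rw [hK, hK, map_sub, hcomm, hcomm g⁻¹]
  have hKK : ∀ g h x, K g (K h x) = K h (K g x) := by
    intro g h x
    rw [hK h, map_sub, hKcomm, hKcomm, ← hK h]
  have hSc : ∀ g, ∃ c : ℝ, ∀ x, S g x = c • x := fun g =>
    exists_eq_smul_of_commute hirr (hSsymm g) fun h x => by
      rw [hS, hS, map_add, hcomm, hcomm g⁻¹]
  have hKm : ∀ g h, ∃ m : ℝ, ∀ x, K g (K h x) = m • x := fun g h =>
    exists_eq_smul_of_commute (A := K g ∘ₗ K h) hirr
      (fun x y => by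
        change inner ℝ (K g (K h x)) y = inner ℝ x (K g (K h y))
        rw [hKskew, hKskew, neg_neg, hKK])
      fun k x => by
        change K g (K h (ρ k x)) = ρ k (K g (K h x))
        rw [hKcomm, hKcomm]
  -- If every K h vanished, ρ h would equal its inverse, so every square, hence every element, would
  -- act trivially.
  obtain ⟨g₀, x₀, hx₀⟩ : ∃ g₀ x₀, K g₀ x₀ ≠ 0 := by
    by_contra hcon
    push Not at hcon
    obtain ⟨x, hx⟩ := exists_ne (0 : E)
    refine hx (hfix x fun g => ?_)
    obtain ⟨h, rfl⟩ := hsq g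
    have h1 : ρ h x = ρ h⁻¹ x := sub_eq_zero.1 ((hK h x).symm.trans (hcon h x))
    rw [mul_apply, h1, map_inv]
    simp
  obtain ⟨m₀, hm₀⟩ := hKm g₀ g₀
  have hneg : m₀ < 0 := by
    -- The square of a nonzero skew operator is a negative scalar m₀ when it is scalar at all;
    -- dividing K g₀ by the square root of -m₀ gives J.
    have h1 : inner ℝ (K g₀ (K g₀ x₀)) x₀ = -inner ℝ (K g₀ x₀) (K g₀ x₀) := hKskew _ _ _
    rw [hm₀, inner_smul_left, real_inner_self_eq_norm_sq, real_inner_self_eq_norm_sq] at h1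
    have h2 : 0 < ‖K g₀ x₀‖ ^ 2 := by positivity
    simp only [conj_trivial] at h1
    by_contra hcon
    push Not at hcon
    nlinarith [mul_nonneg hcon (sq_nonneg ‖x₀‖)]
  set k := Real.sqrt (-m₀) with hk
  have hk0 : k ≠ 0 := (Real.sqrt_pos.2 (neg_pos.2 hneg)).ne'
  have hkk : k * k = -m₀ := Real.mul_self_sqrt (neg_pos.2 hneg).le
  refine ⟨k⁻¹ • K g₀, fun x => ?_, fun x y => ?_, fun g => ?_⟩
  · simp only [LinearMap.smul_apply, map_smul, hm₀, smul_smul]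
    rw [← neg_one_smul ℝ x]
    congr 1
    field_simp
    rw [pow_two, hkk]
    ring
  · simp only [LinearMap.smul_apply, inner_smul_left, inner_smul_right, hKskew, conj_trivial]
    ring
  · obtain ⟨c, hc⟩ := hSc g
    obtain ⟨m, hm⟩ := hKm g g₀
    -- From m₀ K g = (K g K g₀) K g₀ = m K g₀, each K g is m / m₀ times K g₀ = k J. The halves come
    -- from ρ g = (S g + K g) / 2.
    refine ⟨c / 2, m / m₀ * k / 2, fun x => ?_⟩
    have h1 : m₀ • K g x = m • K g₀ x := by
      rw [← map_smul, ← hm₀, hm]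
    have h2 : K g x = (m / m₀) • K g₀ x := by
      rw [div_eq_inv_mul, mul_smul, ← h1, smul_smul, inv_mul_cancel₀ hneg.ne, one_smul]
    have h3 : ρ g x = (1 / 2 : ℝ) • (S g x + K g x) := by
      rw [hS, hK]
      module
    rw [h3, hc, h2, LinearMap.smul_apply, smul_smul, smul_add, smul_smul, smul_smul]
    congr 2
    · ring
    · field_simp

/-- An irreducible orthogonal representation without nonzero fixed vectors, of a connected
commutative group all of whose elements are squares, is transitive on the unit sphere. -/
theorem exists_apply_eq_of_irreducible [TopologicalSpace G] [PreconnectedSpace G]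
    {ρ : G →* (E ≃ₗᵢ[ℝ] E)} (hρ : ∀ x, Continuous fun g => ρ g x)
    (hsq : ∀ g : G, ∃ h, h * h = g) (hfix : ∀ x, (∀ g, ρ g x = x) → x = 0)
    (hirr : ∀ W : Submodule ℝ E, (∀ g, ∀ x ∈ W, ρ g x ∈ W) → W = ⊥ ∨ W = ⊤) {x y : E}
    (hx : ‖x‖ = 1) (hy : ‖y‖ = 1) : ∃ g, ρ g x = y := by
  have hx0 : x ≠ 0 := norm_ne_zero_iff.1 (by rw [hx]; exact one_ne_zero)
  have : Nontrivial E := ⟨x, 0, hx0⟩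
  obtain ⟨J, hJJ, hJ, hJρ⟩ := exists_complexStructure hsq hfix hirr
  choose c d hcd using hJρ
  have hxJ : inner ℝ x (J x) = 0 := by
    have h1 := hJ x x
    rw [real_inner_comm] at h1
    linarith
  have hnorm : ∀ a b : ℝ, ‖a • x + b • J x‖ ^ 2 = a ^ 2 + b ^ 2 := by
    intro a b
    have hJJx : inner ℝ (J x) (J x) = (1 : ℝ) := by
      rw [hJ, hJJ, inner_neg_right, neg_neg, real_inner_self_eq_norm_sq, hx, one_pow]
    have hxx : inner ℝ x x = (1 : ℝ) := by
      rw [real_inner_self_eq_norm_sq, hx, one_pow]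
    rw [← real_inner_self_eq_norm_sq]
    simp only [inner_add_left, inner_add_right, inner_smul_left, inner_smul_right, hJJx, hxx, hxJ,
      real_inner_comm x (J x), conj_trivial]
    ring
  have hcd1 : ∀ g, c g ^ 2 + d g ^ 2 = 1 := by
    intro g
    rw [← hnorm, ← hcd, LinearIsometryEquiv.norm_map, hx, one_pow]
  have hc : ∀ g, c g = inner ℝ (ρ g x) x := by
    intro g
    rw [hcd, inner_add_left, inner_smul_left, inner_smul_left, real_inner_comm x (J x), hxJ,
      real_inner_self_eq_norm_sq, hx]
    simp
  have hcc : Continuous c := by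
    rw [funext hc]
    exact (hρ x).inner continuous_const
  have hc1 : c 1 = 1 := by
    rw [hc, one_apply, real_inner_self_eq_norm_sq, hx, one_pow]
  obtain ⟨g₁, hg₁⟩ : ∃ g, c g < 1 := by
    by_contra hcon
    push Not at hcon
    refine hx0 (hfix x fun g => ?_)
    have h1 := hcd1 g
    have h2 : d g = 0 := by nlinarith [hcon g, sq_nonneg (d g)]
    have h3 : c g = 1 := by nlinarith [hcon g]
    rw [hcd, h2, h3, one_smul, zero_smul, add_zero]
  -- The unit complex numbers whose multiplication, with J as imaginary unit, is realised by some
  -- group element.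
  let H : Subgroup Circle :=
    { carrier := {z | ∃ g, ∀ v, ρ g v = (z : ℂ).re • v + (z : ℂ).im • J v}
      one_mem' := ⟨1, fun v => by simp⟩
      mul_mem' := by
        rintro z w ⟨g, hg⟩ ⟨h, hh⟩
        refine ⟨g * h, fun v => ?_⟩
        rw [mul_apply, hh, hg]
        simp only [map_add, map_smul, hJJ, Circle.coe_mul, Complex.mul_re, Complex.mul_im]
        module
      inv_mem' := by
        rintro z ⟨g, hg⟩
        refine ⟨g⁻¹, fun v => (ρ g).injective ?_⟩
        have hz : (z : ℂ).re ^ 2 + (z : ℂ).im ^ 2 = 1 := by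
          have := Circle.normSq_coe z
          rw [Complex.normSq_apply] at this
          linarith
        have h1 : ρ g (ρ g⁻¹ v) = v := by
          rw [map_inv]
          simp
        rw [h1, hg, Circle.coe_inv_eq_conj]
        simp only [map_add, map_smul, hJJ, Complex.conj_re, Complex.conj_im]
        trans ((z : ℂ).re ^ 2 + (z : ℂ).im ^ 2) • v
        · rw [hz, one_smul]
        · module }
  -- By connectedness, c takes every value between c g₁ and 1. This fixes d up to sign, and
  -- inversion corrects the sign. So H contains an arc around 1, is open, and is the whole circle.
  have hsub : {z : Circle | c g₁ < (z : ℂ).re} ⊆ H := by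
    intro z hz
    have hz1 : (z : ℂ).re ≤ 1 := (Complex.re_le_norm _).trans (Circle.norm_coe z).le
    obtain ⟨g, hg⟩ := mem_range_of_exists_le_of_exists_ge hcc ⟨g₁, le_of_lt hz⟩
      ⟨1, hz1.trans hc1.ge⟩
    have hz2 : (z : ℂ).re ^ 2 + (z : ℂ).im ^ 2 = 1 := by
      have := Circle.normSq_coe z
      rw [Complex.normSq_apply] at this
      linarith
    have hdz : d g ^ 2 = (z : ℂ).im ^ 2 := by
      have := hcd1 g
      rw [hg] at this
      linarith
    rcases sq_eq_sq_iff_eq_or_eq_neg.1 hdz with h | h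
    · exact ⟨g, fun v => by rw [hcd, hg, h]⟩
    · refine inv_mem_iff.1 (⟨g, fun v => ?_⟩ : z⁻¹ ∈ H)
      rw [hcd, hg, h, Circle.coe_inv_eq_conj, Complex.conj_re, Complex.conj_im]
  have hopen : IsOpen (H : Set Circle) := by
    refine H.isOpen_of_mem_nhds (g := 1) (Filter.mem_of_superset (IsOpen.mem_nhds ?_ ?_) hsub)
    · exact isOpen_lt continuous_const (Complex.continuous_re.comp continuous_subtype_val)
    · simpa using hg₁
  have huniv : (H : Set Circle) = univ :=
    IsClopen.eq_univ ⟨H.isClosed_of_isOpen hopen, hopen⟩ ⟨1, H.one_mem⟩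
  -- This plane is invariant, so y is a combination of x and J x; its coefficients form a point of
  -- the circle.
  have hspan : Submodule.span ℝ {x, J x} = ⊤ := by
    refine (hirr _ fun g v hv => ?_).resolve_left fun h => ?_
    · obtain ⟨a, b, rfl⟩ := Submodule.mem_span_pair.1 hv
      rw [hcd]
      refine Submodule.mem_span_pair.2 ⟨c g * a - d g * b, c g * b + d g * a, ?_⟩
      simp only [map_add, map_smul, hJJ]
      module
    · apply hx0
      rw [← Submodule.mem_bot ℝ, ← h]
      exact Submodule.subset_span (by simp)
  obtain ⟨a, b, hab⟩ := Submodule.mem_span_pair.1 (hspan ▸ Submodule.mem_top : y ∈ _)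
  have hab1 : a ^ 2 + b ^ 2 = 1 := by rw [← hnorm, hab, hy, one_pow]
  let z : Circle := ⟨⟨a, b⟩, by
    change (⟨a, b⟩ : ℂ) ∈ sphere (0 : ℂ) 1
    rw [mem_sphere_zero_iff_norm, ← sq_eq_sq₀ (norm_nonneg _) zero_le_one, Complex.sq_norm,
      Complex.normSq_mk]
    linarith⟩
  obtain ⟨g, hg⟩ : z ∈ (H : Set Circle) := huniv ▸ mem_univ z
  exact ⟨g, by rw [hg, ← hab]⟩

/-- A nonzero orthogonal representation without nonzero fixed vectors, of a group all of whose
elements are squares, has dimension at least two. -/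
theorem one_lt_finrank_of_no_fixed [Nontrivial E] {ρ : G →* (E ≃ₗᵢ[ℝ] E)}
    (hsq : ∀ g : G, ∃ h, h * h = g) (hfix : ∀ x, (∀ g, ρ g x = x) → x = 0) :
    1 < Module.finrank ℝ E := by
  by_contra hcon
  have h1 : Module.finrank ℝ E = 1 := by
    have := Module.finrank_pos (R := ℝ) (M := E)
    omega
  obtain ⟨x, hx⟩ := exists_ne (0 : E)
  refine hx (hfix x fun g => ?_)
  obtain ⟨h, rfl⟩ := hsq g
  -- On a line each isometry is a sign, so squares act trivially.
  obtain ⟨c, hc⟩ := (finrank_eq_one_iff_of_nonzero' x hx).1 h1 (ρ h x)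
  have hn : |c| = 1 := by
    have := congrArg norm hc
    rw [norm_smul, LinearIsometryEquiv.norm_map] at this
    exact (mul_eq_right₀ (norm_ne_zero_iff.2 hx)).1 this
  rw [mul_apply, ← hc, map_smul, ← hc, smul_smul, ← abs_mul_abs_self,
    hn, one_mul, one_smul]

end OrthogonalAction

/-! ### Induction on the dimension and conclusion -/

namespace OrthogonalAction

/-- The orbit space of the unit sphere of a nonzero orthogonal representation without nonzero fixed
vectors is simply connected. -/
theorem simplyConnectedSpace_of_no_fixed {G : Type*} [CommGroup G] [TopologicalSpace G]
    [PreconnectedSpace G] (hsq : ∀ g : G, ∃ h, h * h = g) (d : ℕ) :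
    ∀ (E : Type*) [NormedAddCommGroup E] [InnerProductSpace ℝ E] [FiniteDimensional ℝ E]
      [Nontrivial E] (ρ : G →* (E ≃ₗᵢ[ℝ] E)), (∀ x, Continuous fun g => ρ g x) →
      (∀ x, (∀ g, ρ g x = x) → x = 0) → Module.finrank ℝ E = d →
      SimplyConnectedSpace (SphereQuotient ρ) := by
  induction d using Nat.strong_induction_on with
  | _ d ih =>
    intro E _ _ _ _ ρ hρ hfix hd
    by_cases hirr : ∀ W : Submodule ℝ E, (∀ g, ∀ x ∈ W, ρ g x ∈ W) → W = ⊥ ∨ W = ⊤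
    · have hsub : Subsingleton (SphereQuotient ρ) := by
        refine ⟨fun a b => ?_⟩
        obtain ⟨x, rfl⟩ := (isOpenQuotientMap_orbitClass ρ).surjective a
        obtain ⟨y, rfl⟩ := (isOpenQuotientMap_orbitClass ρ).surjective b
        exact orbitClass_eq_iff.2 (exists_apply_eq_of_irreducible hρ hsq hfix hirr
          (mem_sphere_zero_iff_norm.1 y.2) (mem_sphere_zero_iff_norm.1 x.2))
      obtain ⟨v, hv⟩ := exists_ne (0 : E)
      have hne : Nonempty (SphereQuotient ρ) := ⟨orbitClass ρ (unitVector ⟨v, hv⟩)⟩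
      infer_instance
    · push Not at hirr
      obtain ⟨W, hW, hbot, htop⟩ := hirr
      have hbot' : Wᗮ ≠ ⊥ := fun h => htop (Submodule.orthogonal_eq_bot_iff.1 h)
      have hsum := Submodule.finrank_add_finrank_orthogonal W
      have hfixr : ∀ (V : Submodule ℝ E) (hV : ∀ g, ∀ x ∈ V, ρ g x ∈ V) (x : V),
          (∀ g, restrict ρ V hV g x = x) → x = 0 := fun V hV x hx =>
        Subtype.ext (hfix x fun g => congrArg Subtype.val (hx g))
      have hcont : ∀ (V : Submodule ℝ E) (hV : ∀ g, ∀ x ∈ V, ρ g x ∈ V) (x : V),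
          Continuous fun g => restrict ρ V hV g x := fun V hV x => (hρ x).subtype_mk _
      have : Nontrivial W := Submodule.nontrivial_iff_ne_bot.2 hbot
      have : Nontrivial Wᗮ := Submodule.nontrivial_iff_ne_bot.2 hbot'
      -- Neither summand has nonzero fixed vectors, so both have dimension at least two, as
      -- path-connectedness of the pieces requires; both dimensions are below d.
      have h1 := one_lt_finrank_of_no_fixed hsq (hfixr W hW)
      have h2 := one_lt_finrank_of_no_fixed hsq (hfixr Wᗮ (orthogonal_invariant hW))
      exact simplyConnectedSpace_of_invariant hW h1 h2
        (ih _ (by omega) W _ (hcont _ _) (hfixr _ _) rfl)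
        (ih _ (by omega) Wᗮ _ (hcont _ _) (hfixr _ _) rfl)

/-- The orbit space of the unit sphere of an orthogonal representation of dimension at least three,
of a connected commutative group all of whose elements are squares, is simply connected. -/
theorem simplyConnectedSpace_sphereQuotient {G E : Type*} [CommGroup G] [TopologicalSpace G]
    [PreconnectedSpace G] [NormedAddCommGroup E] [InnerProductSpace ℝ E] [FiniteDimensional ℝ E]
    (hsq : ∀ g : G, ∃ h, h * h = g) {ρ : G →* (E ≃ₗᵢ[ℝ] E)}
    (hρ : ∀ x, Continuous fun g => ρ g x) (hE : 3 ≤ Module.finrank ℝ E) :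
    SimplyConnectedSpace (SphereQuotient ρ) := by
  by_cases hfix : ∀ x, (∀ g, ρ g x = x) → x = 0
  · have : Nontrivial E := Module.nontrivial_of_finrank_pos (R := ℝ) (by omega)
    exact simplyConnectedSpace_of_no_fixed hsq _ E ρ hρ hfix rfl
  -- Only this case needs dimension three: the trivial action on a plane has a circle as orbit
  -- space.
  · push Not at hfix
    obtain ⟨e, he, he0⟩ := hfix
    refine simplyConnectedSpace_of_fixed (e := ‖e‖⁻¹ • e) ?_ (fun g => ?_) hE
    · rw [norm_smul, norm_inv, norm_norm, inv_mul_cancel₀ (norm_ne_zero_iff.2 he0)]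
    · rw [map_smul, he]

end OrthogonalAction

theorem Circle.exists_mul_self_eq (z : Circle) : ∃ w : Circle, w * w = z :=
  ⟨Circle.exp ((z : ℂ).arg / 2), by rw [← Circle.exp_add, add_halves, Circle.exp_arg]⟩

/-- Of the torus only commutativity, connectedness and coordinatewise square roots matter. -/
theorem mainTheorem6 (r n : ℕ) (hn : 2 ≤ n)
    (ρ : TorusQuotient.Torus r →* (TorusQuotient.Space n ≃ₗᵢ[ℝ] TorusQuotient.Space n))
    (hρ : Continuous fun p : TorusQuotient.Torus r × TorusQuotient.Space n => ρ p.1 p.2) :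
    SimplyConnectedSpace (TorusQuotient.OrbitSpace ρ) := by
  have hset : TorusQuotient.orbitSetoid ρ = OrthogonalAction.sphereSetoid ρ := by
    ext x y
    exact TorusQuotient.orbitSetoid_iff ρ x y
  have hsq : ∀ g : TorusQuotient.Torus r, ∃ h, h * h = g := by
    intro g
    choose h hh using fun i => Circle.exists_mul_self_eq (g i)
    exact ⟨h, funext hh⟩
  unfold TorusQuotient.OrbitSpace
  rw [hset]
  refine OrthogonalAction.simplyConnectedSpace_sphereQuotient hsq
    (fun x => hρ.comp (by fun_prop : Continuous fun g => (g, x))) ?_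
  rw [finrank_euclideanSpace_fin]
  omega
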